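/- **Combinatorial group testing (CGT).** Let $x\in\{0,1\}^n$ be an unknown string of Hamming weight $|x|\le k$ (the at most $k$ special items among $n$ items). A query to a subset $S\subseteq[n]$ returns $Q_x(S)=1$ if there is $i\in S$ with $x_i=1$, and $Q_x(S)=0$ otherwise; a quantum algorithm accesses $x$ only through the unitary oracle $|S\rangle|z\rangle\mapsto|S\rangle|z\oplus Q_x(S)\rangle$, and its goal is to output $x$. Quantum algorithms may use intermediate measurements and classical control, so that the number of queries made is a random variable. **Theorem.** 1. There is an absolute constant $C$ such that for all $n$ and $k$ there is a quantum algorithm that, on every input $x\in\{0,1\}^n$ with $|x|\le k$, outputs $x$ with probability $1$ and makes at most $C\,k\log(k+1)$ queries in expectation. So CGT is solved with $O(k\log k)$ expected queries on the worst-case input, independently of $n$. 2. Any quantum algorithm that solves CGT with bounded error makes $\Omega(\sqrt{k})$ queries: for every $0\le\varepsilon<1/2$ there is a constant $c>0$, depending only on $\varepsilon$, such that for all $k\le n$, every quantum algorithm that outputs $x$ with probability at least $1-\varepsilon$ on every input $x\in\{0,1\}^n$ with $|x|\le k$ makes at least $c\sqrt{k}$ queries, even in expectation, on some such input. -/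

import Mathlib

/-- What the classical control of a quantum query algorithm does next: halt with output `y`,
query the oracle and then apply a quantum instrument, or only apply a quantum instrument. -/
inductive ControlStep (Y : Type) where
  | output (y : Y)
  | query
  | measure

/-- Computational basis of the registers of a quantum query algorithm: a query register with basis
`Q`, one answer qubit, and a workspace of dimension `d`. -/
abbrev QReg (Q : Type) (d : ℕ) : Type := Q × Bool × Fin d

/-- The unitary oracle `|q⟩|z⟩|w⟩ ↦ |q⟩|z ⊕ f q⟩|w⟩`, acting on vectors given by their amplitudes
(this basis permutation is an involution, so it may be applied to the index). -/
def applyOracle {Q : Type} {d : ℕ} (f : Q → Bool) (ψ : QReg Q d → ℂ) : QReg Q d → ℂ :=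
  fun i => ψ (i.1, xor i.2.1 (f i.1), i.2.2)

/-- A quantum query algorithm with query register `Q`, outputs in `Y`, intermediate measurements
and classical control. Its course is driven by the transcript of the measurement outcomes obtained
so far (a list, the latest outcome first). At transcript `h` the workspace has dimension `dim h`,
and `control h` is the next step. Unless the algorithm halts, it applies (after the oracle, if it
queries) the quantum instrument whose outcomes are `0, …, outcomes h - 1`, with Kraus operator
`kraus h o` for outcome `o`; the transcript then becomes `o :: h`. A unitary or an isometry is an
instrument with a single outcome. There is no bound on the length of a run. -/
structure QueryAlgorithm (Q Y : Type) [Fintype Q] [DecidableEq Q] where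
  dim : List ℕ → ℕ
  control : List ℕ → ControlStep Y
  init : QReg Q (dim []) → ℂ
  init_unit : ∑ i, ‖init i‖ ^ 2 = 1
  outcomes : List ℕ → ℕ
  kraus : (h : List ℕ) → (o : ℕ) → Matrix (QReg Q (dim (o :: h))) (QReg Q (dim h)) ℂ
  kraus_complete : ∀ h : List ℕ,
    ∑ o ∈ Finset.range (outcomes h), (kraus h o).conjTranspose * kraus h o = 1

namespace QueryAlgorithm

variable {Q Y : Type} [Fintype Q] [DecidableEq Q]

/-- The unnormalised state of the algorithm at transcript `h`, when run with the oracle of `f`.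
It is zero for lists that are not transcripts of a run. -/
noncomputable def state (A : QueryAlgorithm Q Y) (f : Q → Bool) :
    (h : List ℕ) → (QReg Q (A.dim h) → ℂ)
  | [] => A.init
  | o :: h =>
    if o < A.outcomes h then
      match A.control h with
      | ControlStep.output _ => 0
      | ControlStep.query => (A.kraus h o).mulVec (applyOracle f (A.state f h))
      | ControlStep.measure => (A.kraus h o).mulVec (A.state f h)
    else 0

/-- The probability that the run with the oracle of `f` goes through transcript `h`. -/
noncomputable def reachProb (A : QueryAlgorithm Q Y) (f : Q → Bool) (h : List ℕ) : ENNReal :=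
  ENNReal.ofReal (∑ i, ‖A.state f h i‖ ^ 2)

/-- The probability that the run with the oracle of `f` halts with output `y`. -/
noncomputable def outputProb (A : QueryAlgorithm Q Y) (f : Q → Bool) (y : Y) : ENNReal :=
  ∑' h : {h : List ℕ // A.control h = ControlStep.output y}, A.reachProb f h.1

/-- The expected number of queries of the run with the oracle of `f`: the number of queries is the
number of querying transcripts that the run goes through, so that its expectation is the sum of
the probabilities of going through them. -/
noncomputable def expectedQueries (A : QueryAlgorithm Q Y) (f : Q → Bool) : ENNReal :=
  ∑' h : {h : List ℕ // A.control h = ControlStep.query}, A.reachProb f h.1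

end QueryAlgorithm

/-- The number of ones of a bit string. -/
def hammingWt {n : ℕ} (x : Fin n → Bool) : ℕ :=
  (Finset.univ.filter fun i => x i = true).card

/-- The group testing query: does the set `S` contain an item `i` that is special in `x`? -/
def cgtQuery {n : ℕ} (x : Fin n → Bool) (S : Finset (Fin n)) : Bool :=
  decide (∃ i ∈ S, x i = true)

/-- A quantum algorithm for group testing with `n` items: its queries are subsets of the items,
its output is an `n`-bit string. -/
abbrev CGTAlgorithm (n : ℕ) : Type := QueryAlgorithm (Finset (Fin n)) (Fin n → Bool)

/-- `A` solves combinatorial group testing with at most `k` special items with success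
probability at least `p`: on every admissible input `x` it outputs `x` with probability at
least `p`. -/
def SolvesCGT {n : ℕ} (k : ℕ) (A : CGTAlgorithm n) (p : ℝ) : Prop :=
  ∀ x : Fin n → Bool, hammingWt x ≤ k → ENNReal.ofReal p ≤ A.outputProb (cgtQuery x) x

/-!
The lower bound is the hybrid argument. Let `x₀` have exactly `k` ones and let `xᵢ` be `x₀` with the
`i`-th of them removed. A query `S` distinguishes `x₀` from `xᵢ` only if `i` is the only one of `x₀`
in `S`, so every query distinguishes `x₀` from at most one of the `xᵢ`
(`QueryAlgorithm.sum_diffQueries_le`). The overlap of two runs, summed over the ends of the tree of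
transcripts, starts at `1`; measurements preserve it because instruments are complete, and a query
changes it only by terms at distinguishing queries
(`QueryAlgorithm.one_le_overlap_add_diffQueries`). If the outputs are right with
probability above `1 / 2`, the final overlap is bounded away from `1`
(`QueryAlgorithm.end_overlap_le`). Adding the resulting inequalities up over the `k` inputs `xᵢ`,
with the weights `√k` and `1 / √k` in the inequality between arithmetic and geometric means, gives
`k * const ≤ √k * E₀ + (∑ Eᵢ) / √k` for the expected numbers of queries `Eᵢ`. Infinite runs are dealt
with by cutting the tree off at a finite depth; no bound for the length of a run is needed.

The upper bound is given by a Las Vegas algorithm, `searchAlgorithm`, that keeps a set `F` of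
items known to be special and repeats two steps. A test queries the complement of `F` and halts if
there is no special item in it. A search prepares one qubit `√(1 - q)|0⟩ + √q|1⟩` for each item
outside `F`, with `q = 1 / (2 * k)`, queries the resulting superposition of sets, and measures, in
a product basis that contains the prepared state, which qubits have deviated from it. Items that
are not special do not influence the answer, so that their qubits cannot deviate
(`outcomeAmp_eq_zero_of_indep`): all deviating items are special and are added to `F`, without
dependence on `n`. With `j` special items missing, the probability that no qubit deviates is `y ^
2 + (1 - y) ^ 2` for `y = (1 - q) ^ j`, so that a search makes progress with probability at least
`j / (3 * k)` (`progress_bound`). The waiting times add up to a harmonic sum, which the potential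
`SearchStage.cost` records (`sum_weight_mul_cost_le`). A finite expected number of queries makes
the run halt almost surely, and it halts only with `F` complete.
-/

/-! ### The oracle and inner products -/

namespace QueryAlgorithm

section Oracle

variable {Q : Type} [Fintype Q]

/-- The bijection of the basis states that the oracle of `f` induces. -/
def oraclePerm (f : Q → Bool) (d : ℕ) : Equiv.Perm (QReg Q d) where
  toFun i := (i.1, xor i.2.1 (f i.1), i.2.2)
  invFun i := (i.1, xor i.2.1 (f i.1), i.2.2)
  left_inv i := by simp
  right_inv i := by simp

theorem applyOracle_dotProduct_self (f : Q → Bool) {d : ℕ} (v w : QReg Q d → ℂ) :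
    star (applyOracle f v) ⬝ᵥ applyOracle f w = star v ⬝ᵥ w :=
  Equiv.sum_comp (oraclePerm f d) fun i => star (v i) * w i

/-- The inequality between arithmetic and geometric means, weighted by `r`. -/
theorem norm_star_mul_le (a b : ℂ) {r : ℝ} (hr : 0 < r) :
    ‖star a * b‖ ≤ (r * ‖a‖ ^ 2 + r⁻¹ * ‖b‖ ^ 2) / 2 := by
  rw [norm_mul, norm_star]
  have h : 0 ≤ r⁻¹ * (r * ‖a‖ - ‖b‖) ^ 2 := by positivity
  have e : r⁻¹ * (r * ‖a‖ - ‖b‖) ^ 2 = r * ‖a‖ ^ 2 + r⁻¹ * ‖b‖ ^ 2 - 2 * (‖a‖ * ‖b‖) := by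
    field_simp
    ring
  linarith

/-- The squared norm of the part of a state at which the oracles of `f` and `g` differ. -/
noncomputable def diffWeight (f g : Q → Bool) {d : ℕ} (v : QReg Q d → ℂ) : ℝ :=
  ∑ i, if f i.1 = g i.1 then 0 else ‖v i‖ ^ 2

theorem diffWeight_applyOracle (f g f' : Q → Bool) {d : ℕ} (v : QReg Q d → ℂ) :
    diffWeight f g (applyOracle f' v) = diffWeight f g v :=
  Equiv.sum_comp (oraclePerm f' d) fun i => if f i.1 = g i.1 then 0 else ‖v i‖ ^ 2

theorem diffWeight_le (f g : Q → Bool) {d : ℕ} (v : QReg Q d → ℂ) :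
    diffWeight f g v ≤ ∑ i, ‖v i‖ ^ 2 :=
  Finset.sum_le_sum fun i _ => by
    split_ifs
    · positivity
    · exact le_rfl

/-- A query changes an inner product only through the queries that distinguish the two oracles. -/
theorem norm_dotProduct_sub_applyOracle_le (f g : Q → Bool) {d : ℕ} (v w : QReg Q d → ℂ) {r : ℝ}
    (hr : 0 < r) :
    ‖star v ⬝ᵥ w - star (applyOracle f v) ⬝ᵥ applyOracle g w‖ ≤
      r * diffWeight f g v + r⁻¹ * diffWeight f g w := by
  -- Where the oracles agree, both permute the basis states in the same way.
  have hsame : ∑ i : QReg Q d, (if f i.1 = g i.1 then star (v i) * w i else 0) =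
      ∑ i : QReg Q d, if f i.1 = g i.1 then
        star (applyOracle f v i) * applyOracle g w i else 0 := by
    rw [← Equiv.sum_comp (oraclePerm f d)]
    refine Finset.sum_congr rfl fun i _ => ?_
    by_cases h : f i.1 = g i.1
    · simp [oraclePerm, applyOracle, h]
    · simp [oraclePerm, h]
  have hsplit : ∀ v w : QReg Q d → ℂ, star v ⬝ᵥ w =
      ∑ i : QReg Q d, (if f i.1 = g i.1 then star (v i) * w i else 0) +
        ∑ i : QReg Q d, if f i.1 = g i.1 then 0 else star (v i) * w i := by
    intro v w
    rw [← Finset.sum_add_distrib]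
    refine Finset.sum_congr rfl fun i _ => ?_
    split_ifs <;> simp
  have hbd : ∀ v w : QReg Q d → ℂ,
      ‖∑ i : QReg Q d, if f i.1 = g i.1 then 0 else star (v i) * w i‖ ≤
        (r * diffWeight f g v + r⁻¹ * diffWeight f g w) / 2 := by
    intro v w
    rw [diffWeight, diffWeight, Finset.mul_sum, Finset.mul_sum, ← Finset.sum_add_distrib,
      Finset.sum_div]
    refine (norm_sum_le _ _).trans (Finset.sum_le_sum fun i _ => ?_)
    split_ifs
    · simp
    · exact norm_star_mul_le _ _ hr
  have h1 := hbd v w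
  have h2 := hbd (applyOracle f v) (applyOracle g w)
  rw [diffWeight_applyOracle, diffWeight_applyOracle] at h2
  rw [hsplit v w, hsplit (applyOracle f v), hsame, add_sub_add_left_eq_sub]
  refine (norm_sub_le _ _).trans ?_
  linarith

end Oracle

/-! ### Sums over the transcript tree -/

variable {Q Y : Type} [Fintype Q] [DecidableEq Q]

/-- The transcripts of length `m` all of whose entries are possible measurement outcomes. -/
def level (A : QueryAlgorithm Q Y) : ℕ → Finset (List ℕ)
  | 0 => {[]}
  | m + 1 => ((A.level m).sigma fun h => Finset.range (A.outcomes h)).map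
      ⟨fun p => p.2 :: p.1, by
        rintro ⟨h, o⟩ ⟨h', o'⟩ e
        simp only [List.cons.injEq] at e
        obtain ⟨rfl, rfl⟩ := e
        rfl⟩

theorem sum_level_succ {M : Type*} [AddCommMonoid M] (A : QueryAlgorithm Q Y) (m : ℕ)
    (G : List ℕ → M) :
    ∑ h ∈ A.level (m + 1), G h =
      ∑ h ∈ A.level m, ∑ o ∈ Finset.range (A.outcomes h), G (o :: h) := by
  rw [level, Finset.sum_map, Finset.sum_sigma]
  rfl

/-- Telescoping along the tree: what a function of the transcripts loses at the inner nodes and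
what it has left at depth `m` add up to its value at the root. -/
theorem sum_level_add_sum_drop {M : Type*} [AddCommGroup M] (A : QueryAlgorithm Q Y)
    (G : List ℕ → M) (m : ℕ) :
    ∑ h ∈ A.level m, G h + ∑ j ∈ Finset.range m, ∑ h ∈ A.level j,
      (G h - ∑ o ∈ Finset.range (A.outcomes h), G (o :: h)) = G [] := by
  induction m with
  | zero => simp [level]
  | succ m ih =>
    rw [Finset.sum_range_succ, sum_level_succ, ← ih, Finset.sum_sub_distrib]
    abel

theorem length_of_mem_level (A : QueryAlgorithm Q Y) {m : ℕ} {h : List ℕ} (hh : h ∈ A.level m) :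
    h.length = m := by
  induction m generalizing h with
  | zero =>
    rw [level, Finset.mem_singleton] at hh
    simp [hh]
  | succ m ih =>
    rw [level, Finset.mem_map] at hh
    obtain ⟨⟨h', o⟩, hp, rfl⟩ := hh
    exact congrArg (· + 1) (ih (Finset.mem_sigma.1 hp).1)

/-- The probability of going through a transcript, as a real number. -/
noncomputable def weight (A : QueryAlgorithm Q Y) (f : Q → Bool) (h : List ℕ) : ℝ :=
  ∑ i, ‖A.state f h i‖ ^ 2

theorem weight_nonneg (A : QueryAlgorithm Q Y) (f : Q → Bool) (h : List ℕ) :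
    0 ≤ A.weight f h :=
  Finset.sum_nonneg fun _ _ => by positivity

theorem mem_level_of_state_ne_zero (A : QueryAlgorithm Q Y) (f : Q → Bool) (h : List ℕ)
    (hh : A.state f h ≠ 0) : h ∈ A.level h.length := by
  induction h with
  | nil => simp [level]
  | cons o h ih =>
    have ho : o < A.outcomes h := by
      by_contra hc
      exact hh (by simp [state, hc])
    have hs : A.state f h ≠ 0 := by
      intro hz
      apply hh
      rw [state, hz]
      have hO : applyOracle f (0 : QReg Q (A.dim h) → ℂ) = 0 := rfl
      cases A.control h <;> simp [hO]
    rw [List.length_cons, level, Finset.mem_map]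
    exact ⟨⟨h, o⟩, Finset.mem_sigma.2 ⟨ih hs, Finset.mem_range.2 ho⟩, rfl⟩

theorem weight_eq_zero_of_notMem_level (A : QueryAlgorithm Q Y) (f : Q → Bool) (h : List ℕ)
    (hh : h ∉ A.level h.length) : A.weight f h = 0 := by
  have : A.state f h = 0 := by
    by_contra hc
    exact hh (A.mem_level_of_state_ne_zero f h hc)
  simp [weight, this]

open Classical in
/-- A sum of probabilities over the transcripts with a given property may be taken level by
level. -/
theorem tsum_reachProb (A : QueryAlgorithm Q Y) (f : Q → Bool) (P : List ℕ → Prop) :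
    ∑' h : {h : List ℕ // P h}, A.reachProb f h.1 =
      ∑' m, ENNReal.ofReal (∑ h ∈ (A.level m).filter P, A.weight f h) := by
  have e1 : ∑' h : {h : List ℕ // P h}, A.reachProb f h.1 =
      ∑' h : List ℕ, ({h | P h} : Set (List ℕ)).indicator (A.reachProb f) h :=
    tsum_subtype {h | P h} (A.reachProb f)
  rw [e1, ← (Equiv.sigmaFiberEquiv (List.length (α := ℕ))).tsum_eq, ENNReal.tsum_sigma']
  congr 1
  ext m
  rw [ENNReal.ofReal_sum_of_nonneg fun h _ => A.weight_nonneg f h, Finset.sum_filter]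
  have e2 : ∀ c : {h : List ℕ // h.length = m},
      ({h | P h} : Set (List ℕ)).indicator (A.reachProb f)
        (Equiv.sigmaFiberEquiv (List.length (α := ℕ)) ⟨m, c⟩) =
      ({h | P h} : Set (List ℕ)).indicator (A.reachProb f) c.1 := fun c => rfl
  simp_rw [e2]
  refine (tsum_subtype {h : List ℕ | h.length = m}
    (({h | P h} : Set (List ℕ)).indicator (A.reachProb f))).trans ?_
  rw [tsum_eq_sum (s := A.level m)]
  · refine Finset.sum_congr rfl fun h hh => ?_
    simp only [Set.indicator, Set.mem_ofPred_eq, A.length_of_mem_level hh, if_true]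
    rfl
  · intro h hh
    simp only [Set.indicator, Set.mem_ofPred_eq]
    split_ifs with hl hP
    · subst hl
      change ENNReal.ofReal (A.weight f h) = 0
      rw [A.weight_eq_zero_of_notMem_level f h hh, ENNReal.ofReal_zero]
    · rfl
    · rfl

/-! ### Overlaps of runs with two oracles -/

/-- The overlap of the states that the runs with the oracles of `f` and `g` have at a
transcript. -/
noncomputable def overlap (A : QueryAlgorithm Q Y) (f g : Q → Bool) (h : List ℕ) : ℂ :=
  star (A.state f h) ⬝ᵥ A.state g h

theorem overlap_self (A : QueryAlgorithm Q Y) (f : Q → Bool) (h : List ℕ) :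
    A.overlap f f h = (A.weight f h : ℂ) := by
  simp only [overlap, weight, dotProduct, Pi.star_apply, Complex.ofReal_sum]
  refine Finset.sum_congr rfl fun i _ => ?_
  rw [RCLike.star_def, Complex.conj_mul']
  push_cast
  rfl

/-- Instruments preserve inner products, summed over the outcomes. -/
theorem sum_kraus_overlap (A : QueryAlgorithm Q Y) (h : List ℕ)
    (v w : QReg Q (A.dim h) → ℂ) :
    ∑ o ∈ Finset.range (A.outcomes h),
      star ((A.kraus h o).mulVec v) ⬝ᵥ (A.kraus h o).mulVec w = star v ⬝ᵥ w := by
  have e : ∀ o, star ((A.kraus h o).mulVec v) ⬝ᵥ (A.kraus h o).mulVec w =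
      star v ⬝ᵥ ((A.kraus h o).conjTranspose * A.kraus h o).mulVec w := fun o => by
    rw [Matrix.star_mulVec, Matrix.dotProduct_mulVec, Matrix.vecMul_vecMul,
      ← Matrix.dotProduct_mulVec]
  simp_rw [e]
  rw [← dotProduct_sum, ← Matrix.sum_mulVec, A.kraus_complete, Matrix.one_mulVec]

theorem sum_overlap_output (A : QueryAlgorithm Q Y) (f g : Q → Bool) {h : List ℕ} {y : Y}
    (hc : A.control h = ControlStep.output y) :
    ∑ o ∈ Finset.range (A.outcomes h), A.overlap f g (o :: h) = 0 :=
  Finset.sum_eq_zero fun o ho => by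
    simp [overlap, state, hc]

theorem sum_overlap_query (A : QueryAlgorithm Q Y) (f g : Q → Bool) {h : List ℕ}
    (hc : A.control h = ControlStep.query) :
    ∑ o ∈ Finset.range (A.outcomes h), A.overlap f g (o :: h) =
      star (applyOracle f (A.state f h)) ⬝ᵥ applyOracle g (A.state g h) := by
  rw [← A.sum_kraus_overlap h]
  refine Finset.sum_congr rfl fun o ho => ?_
  simp [overlap, state, hc, Finset.mem_range.1 ho]

theorem sum_overlap_measure (A : QueryAlgorithm Q Y) (f g : Q → Bool) {h : List ℕ}
    (hc : A.control h = ControlStep.measure) :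
    ∑ o ∈ Finset.range (A.outcomes h), A.overlap f g (o :: h) = A.overlap f g h := by
  rw [overlap, ← A.sum_kraus_overlap h]
  refine Finset.sum_congr rfl fun o ho => ?_
  simp [overlap, state, hc, Finset.mem_range.1 ho]

theorem overlap_nil (A : QueryAlgorithm Q Y) (f g : Q → Bool) : A.overlap f g [] = 1 := by
  have e : A.overlap f g [] = A.overlap f f [] := rfl
  rw [e, overlap_self]
  have : A.weight f [] = 1 := A.init_unit
  rw [this, Complex.ofReal_one]

theorem weight_nil (A : QueryAlgorithm Q Y) (f : Q → Bool) : A.weight f [] = 1 :=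
  A.init_unit

theorem sum_weight_output (A : QueryAlgorithm Q Y) (f : Q → Bool) {h : List ℕ} {y : Y}
    (hc : A.control h = ControlStep.output y) :
    ∑ o ∈ Finset.range (A.outcomes h), A.weight f (o :: h) = 0 := by
  have := A.sum_overlap_output f f hc
  simp_rw [overlap_self] at this
  exact_mod_cast this

theorem sum_weight_of_not_output (A : QueryAlgorithm Q Y) (f : Q → Bool) {h : List ℕ}
    (hc : ∀ y, A.control h ≠ ControlStep.output y) :
    ∑ o ∈ Finset.range (A.outcomes h), A.weight f (o :: h) = A.weight f h := by
  have key : ∑ o ∈ Finset.range (A.outcomes h), A.overlap f f (o :: h) = A.overlap f f h := by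
    cases e : A.control h with
    | output y => exact absurd e (hc y)
    | query => rw [A.sum_overlap_query f f e, applyOracle_dotProduct_self]; rfl
    | measure => exact A.sum_overlap_measure f f e
  simp_rw [overlap_self] at key
  exact_mod_cast key

open Classical in
/-- Conservation of probability: after `m` steps the run has halted or is at a transcript of
length `m`. -/
theorem sum_weight_level_add_halted (A : QueryAlgorithm Q Y) (f : Q → Bool) (m : ℕ) :
    ∑ h ∈ A.level m, A.weight f h + ∑ j ∈ Finset.range m,
      ∑ h ∈ (A.level j).filter (fun h => ∃ y, A.control h = ControlStep.output y),
        A.weight f h = 1 := by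
  rw [← A.weight_nil f, ← A.sum_level_add_sum_drop (A.weight f) m]
  congr 1
  refine Finset.sum_congr rfl fun j _ => ?_
  rw [Finset.sum_filter]
  refine Finset.sum_congr rfl fun h _ => ?_
  split_ifs with hc
  · obtain ⟨y, hy⟩ := hc
    rw [A.sum_weight_output f hy, sub_zero]
  · rw [A.sum_weight_of_not_output f (by simpa using hc), sub_self]

end QueryAlgorithm

/-! ### Lower bound by the hybrid argument -/

namespace QueryAlgorithm

variable {Q Y : Type} [Fintype Q] [DecidableEq Q]

theorem norm_overlap_le (A : QueryAlgorithm Q Y) (f g : Q → Bool) (h : List ℕ) {r : ℝ}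
    (hr : 0 < r) :
    ‖A.overlap f g h‖ ≤ (r * A.weight f h + r⁻¹ * A.weight g h) / 2 := by
  rw [weight, weight, Finset.mul_sum, Finset.mul_sum, ← Finset.sum_add_distrib, Finset.sum_div]
  exact (norm_sum_le _ _).trans (Finset.sum_le_sum fun i _ => norm_star_mul_le _ _ hr)

open Classical in
/-- The expected number of queries among the first `m` steps, in the run with the oracle of `f'`,
that distinguish `f` from `g`. -/
noncomputable def diffQueries (A : QueryAlgorithm Q Y) (f g : Q → Bool) (f' : Q → Bool)
    (m : ℕ) : ℝ :=
  ∑ j ∈ Finset.range m, ∑ h ∈ (A.level j).filter (fun h => A.control h = ControlStep.query),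
    diffWeight f g (A.state f' h)

open Classical in
/-- The expected number of queries among the first `m` steps. -/
noncomputable def queriesUpTo (A : QueryAlgorithm Q Y) (f : Q → Bool) (m : ℕ) : ℝ :=
  ∑ j ∈ Finset.range m, ∑ h ∈ (A.level j).filter (fun h => A.control h = ControlStep.query),
    A.weight f h

open Classical in
/-- The probability of halting with output `y` within the first `m` steps. -/
noncomputable def outputUpTo (A : QueryAlgorithm Q Y) (f : Q → Bool) (y : Y) (m : ℕ) : ℝ :=
  ∑ j ∈ Finset.range m, ∑ h ∈ (A.level j).filter (fun h => A.control h = ControlStep.output y),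
    A.weight f h

theorem sum_weight_level_add_outputUpTo (A : QueryAlgorithm Q Y) (f : Q → Bool) (y : Y)
    (hy : ∀ h y', A.weight f h ≠ 0 → A.control h = ControlStep.output y' → y' = y) (m : ℕ) :
    ∑ h ∈ A.level m, A.weight f h + A.outputUpTo f y m = 1 := by
  classical
  rw [← A.sum_weight_level_add_halted f m, outputUpTo]
  congr 1
  refine Finset.sum_congr rfl fun j _ => ?_
  rw [Finset.sum_filter, Finset.sum_filter]
  refine Finset.sum_congr rfl fun h _ => ?_
  by_cases hw : A.weight f h = 0
  · simp [hw]
  · by_cases hc : ∃ y', A.control h = ControlStep.output y'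
    · obtain ⟨y', hc⟩ := hc
      obtain rfl := hy h y' hw hc
      simp [hc]
    · rw [if_neg hc, if_neg fun h => hc ⟨y, h⟩]

theorem diffQueries_le (A : QueryAlgorithm Q Y) (f g f' : Q → Bool) (m : ℕ) :
    A.diffQueries f g f' m ≤ A.queriesUpTo f' m :=
  Finset.sum_le_sum fun _ _ => Finset.sum_le_sum fun _ _ => diffWeight_le _ _ _

open Classical in
/-- The runs with two oracles separate only through distinguishing queries: the overlaps at the
ends of the runs account for everything else. -/
theorem one_le_overlap_add_diffQueries (A : QueryAlgorithm Q Y) (f g : Q → Bool) (m : ℕ) {r : ℝ}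
    (hr : 0 < r) :
    1 ≤ (∑ h ∈ A.level m, ‖A.overlap f g h‖ + ∑ j ∈ Finset.range m,
      ∑ h ∈ (A.level j).filter (fun h => ∃ y, A.control h = ControlStep.output y),
        ‖A.overlap f g h‖) +
      (r * A.diffQueries f g f m + r⁻¹ * A.diffQueries f g g m) := by
  have h1 : ‖A.overlap f g []‖ = 1 := by rw [overlap_nil, norm_one]
  rw [← h1, ← A.sum_level_add_sum_drop (A.overlap f g) m, diffQueries, diffQueries,
    Finset.mul_sum, Finset.mul_sum, add_assoc, ← Finset.sum_add_distrib, ← Finset.sum_add_distrib]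
  refine (norm_add_le _ _).trans (add_le_add (norm_sum_le _ _) ?_)
  refine (norm_sum_le _ _).trans (Finset.sum_le_sum fun j _ => ?_)
  refine (norm_sum_le _ _).trans ?_
  rw [Finset.mul_sum, Finset.mul_sum, ← Finset.sum_add_distrib, Finset.sum_filter,
    Finset.sum_filter, ← Finset.sum_add_distrib]
  refine Finset.sum_le_sum fun h _ => ?_
  cases hc : A.control h with
  | output y => simp [A.sum_overlap_output f g hc]
  | query =>
    rw [A.sum_overlap_query f g hc]
    simpa [overlap] using norm_dotProduct_sub_applyOracle_le f g (A.state f h) (A.state g h) hr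
  | measure => simp [A.sum_overlap_measure f g hc]

open Classical in
/-- If `y` is likely to be output with the oracle of `f` and unlikely with that of `g`, then the
two runs end with a small overlap. -/
theorem end_overlap_le (A : QueryAlgorithm Q Y) (f g : Q → Bool) (y : Y) (m : ℕ) {e t : ℝ}
    (ht : 0 < t) (ht1 : t ≤ 1) (hf : 1 - e ≤ A.outputUpTo f y m) (hg : A.outputUpTo g y m ≤ e) :
    ∑ h ∈ A.level m, ‖A.overlap f g h‖ + ∑ j ∈ Finset.range m,
      ∑ h ∈ (A.level j).filter (fun h => ∃ y, A.control h = ControlStep.output y),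
        ‖A.overlap f g h‖ ≤ t * (1 - e) + t⁻¹ * e := by
  -- Weight the ends with output `y` by `t` and the others by `t⁻¹`.
  have hl : ∑ h ∈ A.level m, ‖A.overlap f g h‖ ≤
      (t⁻¹ * ∑ h ∈ A.level m, A.weight f h + t * ∑ h ∈ A.level m, A.weight g h) / 2 := by
    rw [Finset.mul_sum, Finset.mul_sum, ← Finset.sum_add_distrib, Finset.sum_div]
    refine Finset.sum_le_sum fun h _ => ?_
    simpa using A.norm_overlap_le f g h (inv_pos.2 ht)
  have ho : ∑ j ∈ Finset.range m,
      ∑ h ∈ (A.level j).filter (fun h => ∃ y, A.control h = ControlStep.output y),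
        ‖A.overlap f g h‖ ≤
      (t⁻¹ * (∑ j ∈ Finset.range m,
          ∑ h ∈ (A.level j).filter (fun h => ∃ y, A.control h = ControlStep.output y),
            A.weight f h - A.outputUpTo f y m) +
        t * (∑ j ∈ Finset.range m,
          ∑ h ∈ (A.level j).filter (fun h => ∃ y, A.control h = ControlStep.output y),
            A.weight g h - A.outputUpTo g y m)) / 2 +
      (t * A.outputUpTo f y m + t⁻¹ * A.outputUpTo g y m) / 2 := by
    simp only [outputUpTo, ← Finset.sum_sub_distrib, Finset.mul_sum, ← Finset.sum_add_distrib,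
      Finset.sum_div]
    refine Finset.sum_le_sum fun j _ => ?_
    simp only [Finset.sum_filter, ← Finset.sum_sub_distrib, Finset.mul_sum,
      ← Finset.sum_add_distrib, Finset.sum_div]
    refine Finset.sum_le_sum fun h _ => ?_
    by_cases hy : A.control h = ControlStep.output y
    · simpa [hy] using A.norm_overlap_le f g h ht
    · by_cases hx : ∃ y, A.control h = ControlStep.output y
      · simpa [hy, hx] using A.norm_overlap_le f g h (inv_pos.2 ht)
      · simp [hy, hx]
  have cf := A.sum_weight_level_add_halted f m
  have cg := A.sum_weight_level_add_halted g m
  set Lf := ∑ h ∈ A.level m, A.weight f h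
  set Lg := ∑ h ∈ A.level m, A.weight g h
  have hti : t ≤ t⁻¹ := ht1.trans ((one_le_inv₀ ht).2 ht1)
  have key : (t⁻¹ - t) * ((1 - A.outputUpTo f y m) + A.outputUpTo g y m) ≤
      (t⁻¹ - t) * (e + e) :=
    mul_le_mul_of_nonneg_left (by linarith) (by linarith)
  rw [eq_sub_of_add_eq' cf, eq_sub_of_add_eq' cg] at ho
  linarith

theorem tendsto_outputUpTo (A : QueryAlgorithm Q Y) (f : Q → Bool) (y : Y) :
    Filter.Tendsto (fun m => ENNReal.ofReal (A.outputUpTo f y m)) Filter.atTop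
      (nhds (A.outputProb f y)) := by
  classical
  rw [outputProb, tsum_reachProb A f fun h => A.control h = ControlStep.output y]
  have := (ENNReal.summable (f := fun m => ENNReal.ofReal (∑ h ∈ (A.level m).filter
    (fun h => A.control h = ControlStep.output y), A.weight f h))).hasSum.tendsto_sum_nat
  refine this.congr fun m => ?_
  rw [outputUpTo, ENNReal.ofReal_sum_of_nonneg
    fun j _ => Finset.sum_nonneg fun h _ => A.weight_nonneg f h]

theorem outputUpTo_le (A : QueryAlgorithm Q Y) (f : Q → Bool) (y : Y) (m : ℕ) :
    ENNReal.ofReal (A.outputUpTo f y m) ≤ A.outputProb f y := by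
  classical
  rw [outputProb, tsum_reachProb A f fun h => A.control h = ControlStep.output y, outputUpTo,
    ENNReal.ofReal_sum_of_nonneg fun j _ => Finset.sum_nonneg fun h _ => A.weight_nonneg f h]
  exact ENNReal.sum_le_tsum _

theorem queriesUpTo_le (A : QueryAlgorithm Q Y) (f : Q → Bool) (m : ℕ) :
    ENNReal.ofReal (A.queriesUpTo f m) ≤ A.expectedQueries f := by
  classical
  rw [expectedQueries, tsum_reachProb A f fun h => A.control h = ControlStep.query, queriesUpTo,
    ENNReal.ofReal_sum_of_nonneg fun j _ => Finset.sum_nonneg fun h _ => A.weight_nonneg f h]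
  exact ENNReal.sum_le_tsum _

theorem outputUpTo_add_le_one (A : QueryAlgorithm Q Y) (f : Q → Bool) {y y' : Y} (hy : y ≠ y')
    (m : ℕ) : A.outputUpTo f y m + A.outputUpTo f y' m ≤ 1 := by
  classical
  rw [← A.sum_weight_level_add_halted f m]
  refine le_add_of_nonneg_of_le (Finset.sum_nonneg fun h _ => A.weight_nonneg f h) ?_
  rw [outputUpTo, outputUpTo, ← Finset.sum_add_distrib]
  refine Finset.sum_le_sum fun j _ => ?_
  rw [Finset.sum_filter, Finset.sum_filter, Finset.sum_filter, ← Finset.sum_add_distrib]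
  refine Finset.sum_le_sum fun h _ => ?_
  have hw := A.weight_nonneg f h
  by_cases h1 : A.control h = ControlStep.output y
  · simp [h1, hy]
  · by_cases h2 : A.control h = ControlStep.output y'
    · simp [h2, hy.symm]
    · simp only [h1, h2, if_false, add_zero]
      split_ifs
      exacts [hw, le_rfl]

theorem exists_lt_outputUpTo (A : QueryAlgorithm Q Y) (f : Q → Bool) (y : Y) {p q : ℝ}
    (hp : ENNReal.ofReal p ≤ A.outputProb f y) (hq : q < p) (hp0 : 0 < p) :
    ∃ m₀, ∀ m ≥ m₀, q < A.outputUpTo f y m := by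
  have hlt : ENNReal.ofReal q < A.outputProb f y :=
    ((ENNReal.ofReal_lt_ofReal_iff hp0).2 hq).trans_le hp
  obtain ⟨m₀, hm₀⟩ := Filter.eventually_atTop.1
    ((A.tendsto_outputUpTo f y).eventually (lt_mem_nhds hlt))
  exact ⟨m₀, fun m hm => lt_of_not_ge fun hc =>
    absurd (ENNReal.ofReal_le_ofReal hc) (not_le.2 (hm₀ m hm))⟩

/-- Two runs that halt with different outputs, up to a probability of error below `e`, must spend
distinguishing queries. -/
theorem one_le_of_outputProb (A : QueryAlgorithm Q Y) {f g : Q → Bool} {y y' : Y} (hy : y ≠ y')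
    {e t r : ℝ} (ht : 0 < t) (ht1 : t ≤ 1) (hr : 0 < r) {m : ℕ}
    (hf : 1 - e ≤ A.outputUpTo f y m) (hg : 1 - e ≤ A.outputUpTo g y' m) :
    1 ≤ t * (1 - e) + t⁻¹ * e + (r * A.diffQueries f g f m + r⁻¹ * A.queriesUpTo g m) := by
  have h1 := A.one_le_overlap_add_diffQueries f g m hr
  have h2 := A.end_overlap_le f g y m ht ht1 hf
    (by linarith [A.outputUpTo_add_le_one g hy m])
  have h3 := mul_le_mul_of_nonneg_left (A.diffQueries_le f g g m) (inv_pos.2 hr).le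
  linarith

/-- If every query distinguishes `f` from at most one of the oracles `g i`, then the distinguishing
queries add up to at most all queries. -/
theorem sum_diffQueries_le (A : QueryAlgorithm Q Y) (f : Q → Bool) {ι : Type*} (K : Finset ι)
    (g : ι → Q → Bool)
    (hg : ∀ q, ∀ i ∈ K, ∀ j ∈ K, f q ≠ g i q → f q ≠ g j q → i = j) (m : ℕ) :
    ∑ i ∈ K, A.diffQueries f (g i) f m ≤ A.queriesUpTo f m := by
  classical
  simp only [diffQueries]
  rw [Finset.sum_comm]
  refine Finset.sum_le_sum fun j _ => ?_
  rw [Finset.sum_comm]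
  refine Finset.sum_le_sum fun h _ => ?_
  simp only [diffWeight]
  rw [Finset.sum_comm]
  refine Finset.sum_le_sum fun b _ => ?_
  by_cases hb : ∃ i ∈ K, f b.1 ≠ g i b.1
  · obtain ⟨i, hi, hne⟩ := hb
    rw [Finset.sum_eq_single_of_mem i hi]
    · simp [hne]
    · intro i' hi' hii
      rw [if_pos]
      by_contra hc
      exact hii (hg b.1 i' hi' i hi hc hne)
  · push Not at hb
    rw [Finset.sum_eq_zero fun i hi => if_pos (hb i hi)]
    positivity

end QueryAlgorithm

/-- Flipping one of the ones of `x` changes the answer to `S` only if it is the only one in `S`. -/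
theorem cgtQuery_update_ne {n : ℕ} {x : Fin n → Bool} {S : Finset (Fin n)} {i j : Fin n}
    (hi : x i = true) (hj : x j = true)
    (h₁ : cgtQuery x S ≠ cgtQuery (Function.update x i false) S)
    (h₂ : cgtQuery x S ≠ cgtQuery (Function.update x j false) S) : i = j := by
  have key : ∀ i, x i = true → cgtQuery x S ≠ cgtQuery (Function.update x i false) S →
      i ∈ S ∧ ∀ l ∈ S, x l = true → l = i := by
    intro i hi h
    have huniq : ∀ l ∈ S, x l = true → l = i := by
      intro l hl hxl
      by_contra hne
      apply h
      have e1 : cgtQuery x S = true := decide_eq_true ⟨l, hl, hxl⟩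
      have e2 : cgtQuery (Function.update x i false) S = true :=
        decide_eq_true ⟨l, hl, by rw [Function.update_of_ne hne, hxl]⟩
      rw [e1, e2]
    refine ⟨?_, huniq⟩
    by_contra hiS
    apply h
    unfold cgtQuery
    congr 1
    refine propext (exists_congr fun l => and_congr_right fun hl => ?_)
    rw [Function.update_of_ne (by rintro rfl; exact hiS hl)]
  exact (key j hj h₂).2 i (key i hi h₁).1 hi

theorem hammingWt_mono {n : ℕ} {x y : Fin n → Bool} (h : ∀ i, x i = true → y i = true) :
    hammingWt x ≤ hammingWt y :=
  Finset.card_le_card fun i hi => by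
    simp only [Finset.mem_filter, Finset.mem_univ, true_and] at hi ⊢
    exact h i hi

/-- The hard inputs are the one whose special items are the first `k` and those obtained from it
by removing one of them. -/
theorem cgt_lower_bound {ε : ℝ} (hε : ε < 1 / 2) :
    ∃ c : ℝ, 0 < c ∧ ∀ n k : ℕ, k ≤ n → ∀ A : CGTAlgorithm n, SolvesCGT k A (1 - ε) →
      ∃ x : Fin n → Bool, hammingWt x ≤ k ∧
        ENNReal.ofReal (c * Real.sqrt k) ≤ A.expectedQueries (cgtQuery x) := by
  obtain ⟨e, he1, he2⟩ := exists_between hε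
  -- `t` lies between the zeros `e / (1 - e)` and `1` of `(1 - t) * (t * (1 - e) - e)`.
  set t : ℝ := (2 * (1 - e))⁻¹ with ht_def
  have hd : 0 < 2 * (1 - e) := by linarith
  have ht : 0 < t := inv_pos.2 hd
  have ht1 : t ≤ 1 := inv_le_one_of_one_le₀ (by linarith)
  set γ : ℝ := t * (1 - e) + t⁻¹ * e with hγ
  have hγ1 : γ < 1 := by
    have : t * (1 - e) = 1 / 2 := by
      have : (1 - e) ≠ 0 := by linarith
      rw [ht_def]; field_simp
    rw [hγ, this, ht_def, inv_inv]
    nlinarith [mul_pos (sub_pos.2 he2) (sub_pos.2 he2)]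
  refine ⟨(1 - γ) / 2, by linarith, fun n k hkn A hA => ?_⟩
  set x₀ : Fin n → Bool := fun i => decide (i.1 < k) with hx₀
  set K : Finset (Fin n) := Finset.univ.filter fun i => x₀ i = true with hK
  have hKcard : K.card = k := by
    have : K = Finset.univ.filter fun i : Fin n => i.1 < k := by simp [hK, hx₀]
    rw [this, Fin.card_filter_val_lt, min_eq_right hkn]
  have hwt0 : hammingWt x₀ ≤ k := hKcard.le
  have hwt : ∀ i, hammingWt (Function.update x₀ i false) ≤ k := fun i =>
    (hammingWt_mono fun l hl => by
      by_cases h : l = i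
      · subst h; simp at hl
      · rwa [Function.update_of_ne h] at hl).trans hwt0
  rcases Nat.eq_zero_or_pos k with rfl | hk
  · exact ⟨x₀, hwt0, by simp⟩
  by_contra! hcon
  have hkR : (0 : ℝ) < k := by exact_mod_cast hk
  have hs : 0 < Real.sqrt k := Real.sqrt_pos.2 hkR
  set T : ℝ := (1 - γ) / 2 * Real.sqrt k with hT
  have hT0 : 0 < T := mul_pos (by linarith) hs
  have hq : ∀ x : Fin n → Bool, hammingWt x ≤ k → ∀ m, A.queriesUpTo (cgtQuery x) m < T :=
    fun x hx m => (ENNReal.ofReal_lt_ofReal_iff hT0).1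
      ((A.queriesUpTo_le (cgtQuery x) m).trans_lt (hcon x hx))
  have hout : ∀ x : Fin n → Bool, hammingWt x ≤ k →
      ∃ m₀, ∀ m ≥ m₀, 1 - e < A.outputUpTo (cgtQuery x) x m := fun x hx =>
    A.exists_lt_outputUpTo _ x (hA x hx) (by linarith) (by linarith)
  choose! N hN using hout
  set m := max (N x₀) (K.sup fun i => N (Function.update x₀ i false)) with hm
  have hmain : ∀ i ∈ K, 1 - γ ≤ Real.sqrt k *
      A.diffQueries (cgtQuery x₀) (cgtQuery (Function.update x₀ i false)) (cgtQuery x₀) m +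
        (Real.sqrt k)⁻¹ * T := by
    intro i hi
    have hne : x₀ ≠ Function.update x₀ i false := by
      intro h
      have h1 : x₀ i = true := (Finset.mem_filter.1 hi).2
      rw [h] at h1
      simp at h1
    have h1 := A.one_le_of_outputProb hne ht ht1 hs (hN x₀ hwt0 m (le_max_left _ _)).le
      (hN _ (hwt i) m ((Finset.le_sup (f := fun i => N (Function.update x₀ i false)) hi).trans
        (le_max_right _ _))).le
    have h2 := mul_le_mul_of_nonneg_left (hq _ (hwt i) m).le (inv_pos.2 hs).le
    linarith
  have hsum := Finset.sum_le_sum hmain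
  rw [Finset.sum_const, hKcard, Finset.sum_add_distrib, Finset.sum_const, hKcard,
    ← Finset.mul_sum, nsmul_eq_mul, nsmul_eq_mul] at hsum
  have hD := A.sum_diffQueries_le (cgtQuery x₀) K
    (fun i => cgtQuery (Function.update x₀ i false))
    (fun S i hi j hj h₁ h₂ => cgtQuery_update_ne (Finset.mem_filter.1 hi).2
      (Finset.mem_filter.1 hj).2 h₁ h₂) m
  have hD' := mul_lt_mul_of_pos_left (hD.trans_lt (hq x₀ hwt0 m)) hs
  have hsq : Real.sqrt k * Real.sqrt k = k := Real.mul_self_sqrt hkR.le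
  have e1 : (k : ℝ) * ((Real.sqrt k)⁻¹ * T) = Real.sqrt k * T := by
    rw [← mul_assoc, ← div_eq_mul_inv, Real.div_sqrt]
  have e2 : Real.sqrt k * T = (1 - γ) / 2 * k := by rw [hT]; linear_combination ((1 - γ) / 2) * hsq
  rw [e1] at hsum
  linarith

/-! ### Product measurements on subsets -/

/-- The real orthogonal reflection with first row `(c, s)`, for `c ^ 2 + s ^ 2 = 1`. -/
def reflectionEntry (c s : ℝ) : Bool → Bool → ℝ
  | false, false => c
  | false, true => s
  | true, false => s
  | true, true => -c

/-- The tensor product of the reflections `reflectionEntry (c i) (s i)`. Sets of items are the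
basis states of a register with one qubit for each item. -/
def reflectionProd {n : ℕ} (c s : Fin n → ℝ) (U T : Finset (Fin n)) : ℝ :=
  ∏ i, reflectionEntry (c i) (s i) (decide (i ∈ U)) (decide (i ∈ T))

/-- Distributivity, with sets in place of the choices of a summand for each factor. -/
theorem sum_finset_prod {n : ℕ} (g : Fin n → Bool → ℝ) :
    ∑ T : Finset (Fin n), ∏ i, g i (decide (i ∈ T)) = ∏ i, (g i true + g i false) := by
  rw [Finset.prod_add, Finset.powerset_univ]
  refine Finset.sum_congr rfl fun T _ => ?_
  rw [← Finset.compl_eq_univ_sdiff, ← Finset.prod_mul_prod_compl T]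
  congr 1
  · exact Finset.prod_congr rfl fun i hi => by simp [hi]
  · exact Finset.prod_congr rfl fun i hi => by simp [Finset.mem_compl.1 hi]

/-- The rows of `reflectionProd c s` are orthonormal. -/
theorem sum_reflectionProd_mul {n : ℕ} {c s : Fin n → ℝ} (h : ∀ i, c i ^ 2 + s i ^ 2 = 1)
    (T T' : Finset (Fin n)) :
    ∑ U, reflectionProd c s U T * reflectionProd c s U T' = if T = T' then 1 else 0 := by
  simp only [reflectionProd, ← Finset.prod_mul_distrib]
  rw [sum_finset_prod fun i u => reflectionEntry (c i) (s i) u (decide (i ∈ T)) *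
    reflectionEntry (c i) (s i) u (decide (i ∈ T'))]
  split_ifs with hT
  · subst hT
    refine Finset.prod_eq_one fun i _ => ?_
    have := h i
    by_cases hi : i ∈ T <;> simp [hi, reflectionEntry] <;> linarith
  · obtain ⟨i, hi⟩ : ∃ i, ¬(i ∈ T ↔ i ∈ T') := by
      by_contra! hc
      exact hT (Finset.ext hc)
    refine Finset.prod_eq_zero (Finset.mem_univ i) ?_
    by_cases h1 : i ∈ T <;> by_cases h2 : i ∈ T' <;> simp [h1, h2] at hi <;>
      simp [h1, h2, reflectionEntry] <;> ring

/-- The amplitude of measuring the set `U` together with the answer `z`, after the state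
`reflectionProd c s ∅` has been sent through the oracle of `f`. -/
def outcomeAmp {n : ℕ} (f : Finset (Fin n) → Bool) (c s : Fin n → ℝ) (U : Finset (Fin n))
    (z : Bool) : ℝ :=
  ∑ T, if f T = z then reflectionProd c s U T * reflectionProd c s ∅ T else 0

/-- Items that do not influence the answer are never measured as deviating: the terms of `T` and
of `T` with `j` added or removed cancel. -/
theorem outcomeAmp_eq_zero_of_indep {n : ℕ} {f : Finset (Fin n) → Bool} {c s : Fin n → ℝ}
    {U : Finset (Fin n)} {j : Fin n} (hj : j ∈ U)
    (hf : ∀ T, f (symmDiff T {j}) = f T) (z : Bool) : outcomeAmp f c s U z = 0 := by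
  have hmem : ∀ T : Finset (Fin n), j ∈ symmDiff T {j} ↔ j ∉ T := fun T => by
    simp [Finset.mem_symmDiff]
  have hmem' : ∀ (T : Finset (Fin n)) (i), i ≠ j → (i ∈ symmDiff T {j} ↔ i ∈ T) :=
    fun T i hi => by simp [Finset.mem_symmDiff, hi]
  have hneg : ∀ T : Finset (Fin n),
      reflectionProd c s U (symmDiff T {j}) * reflectionProd c s ∅ (symmDiff T {j}) =
        -(reflectionProd c s U T * reflectionProd c s ∅ T) := by
    intro T
    simp only [reflectionProd, ← Finset.prod_mul_distrib]
    rw [← Finset.mul_prod_erase _ _ (Finset.mem_univ j),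
      ← Finset.mul_prod_erase _ _ (Finset.mem_univ j), ← neg_mul]
    congr 1
    · by_cases h : j ∈ T
      · simp [hmem, h, hj, reflectionEntry]; ring
      · simp [hmem, h, hj, reflectionEntry]; ring
    · refine Finset.prod_congr rfl fun i hi => ?_
      simp only [hmem' T i (Finset.ne_of_mem_erase hi)]
  have hinv : Function.Involutive fun T : Finset (Fin n) => symmDiff T {j} := fun T => by
    simp
  have hself : outcomeAmp f c s U z = -outcomeAmp f c s U z := by
    conv_lhs => rw [outcomeAmp, ← Equiv.sum_comp hinv.toPerm]
    rw [outcomeAmp, ← Finset.sum_neg_distrib]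
    refine Finset.sum_congr rfl fun T _ => ?_
    simp only [Function.Involutive.coe_toPerm, hf, hneg]
    split_ifs <;> simp
  linarith

theorem cgtQuery_symmDiff {n : ℕ} {x : Fin n → Bool} {j : Fin n} (hj : x j = false)
    (T : Finset (Fin n)) : cgtQuery x (symmDiff T {j}) = cgtQuery x T := by
  unfold cgtQuery
  congr 1
  refine propext (exists_congr fun i => and_congr_left fun hi => ?_)
  have : i ≠ j := by rintro rfl; simp [hj] at hi
  simp [Finset.mem_symmDiff, this]

/-- Amplitudes of the items: an item outside `F` is in the queried set with probability `q`, an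
item of `F` never. -/
noncomputable def cosAmp {n : ℕ} (F : Finset (Fin n)) (q : ℝ) (i : Fin n) : ℝ :=
  if i ∈ F then 1 else √(1 - q)

/-- See `cosAmp`. -/
noncomputable def sinAmp {n : ℕ} (F : Finset (Fin n)) (q : ℝ) (i : Fin n) : ℝ :=
  if i ∈ F then 0 else √q

theorem cosAmp_sq_add_sinAmp_sq {n : ℕ} (F : Finset (Fin n)) {q : ℝ} (h0 : 0 ≤ q) (h1 : q ≤ 1)
    (i : Fin n) : cosAmp F q i ^ 2 + sinAmp F q i ^ 2 = 1 := by
  unfold cosAmp sinAmp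
  split_ifs
  · norm_num
  · rw [Real.sq_sqrt h0, Real.sq_sqrt (by linarith)]; ring

/-- The number of special items outside `F`. -/
def missing {n : ℕ} (x : Fin n → Bool) (F : Finset (Fin n)) : ℕ :=
  (Finset.univ.filter fun i => x i = true ∧ i ∉ F).card

/-- The qubits of the items found are in a fixed basis state and never deviate. -/
theorem outcomeAmp_of_mem {n : ℕ} (f : Finset (Fin n) → Bool) {F U : Finset (Fin n)} {q : ℝ}
    {j : Fin n} (hF : j ∈ F) (hU : j ∈ U) (z : Bool) :
    outcomeAmp f (cosAmp F q) (sinAmp F q) U z = 0 := by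
  refine Finset.sum_eq_zero fun T _ => ?_
  have : reflectionProd (cosAmp F q) (sinAmp F q) U T *
      reflectionProd (cosAmp F q) (sinAmp F q) ∅ T = 0 := by
    simp only [reflectionProd, ← Finset.prod_mul_distrib]
    refine Finset.prod_eq_zero (Finset.mem_univ j) ?_
    by_cases hT : j ∈ T <;> simp [hF, hU, hT, cosAmp, sinAmp, reflectionEntry]
  rw [this, ite_self]

/-- For `q = 1` the queried set is the complement of `F`. -/
theorem outcomeAmp_one {n : ℕ} (f : Finset (Fin n) → Bool) {F U : Finset (Fin n)} {z : Bool}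
    (hz : f Fᶜ ≠ z) : outcomeAmp f (cosAmp F 1) (sinAmp F 1) U z = 0 := by
  refine Finset.sum_eq_zero fun T _ => ?_
  split_ifs with h
  · obtain ⟨i, hi⟩ : ∃ i, ¬(i ∈ T ↔ i ∈ Fᶜ) := by
      by_contra! hc
      rw [Finset.ext hc] at h
      exact hz h
    have : reflectionProd (cosAmp F 1) (sinAmp F 1) ∅ T = 0 := by
      refine Finset.prod_eq_zero (Finset.mem_univ i) ?_
      by_cases hT : i ∈ T <;> by_cases hF : i ∈ F <;> simp [hT, hF] at hi <;>
        simp [hF, hT, cosAmp, sinAmp, reflectionEntry]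
    rw [this, mul_zero]
  · rfl

/-- The amplitude of a negative answer without deviating items is the probability that a random
set with density `q` misses all special items outside `F`. -/
theorem outcomeAmp_empty_false {n : ℕ} (x : Fin n → Bool) (F : Finset (Fin n)) {q : ℝ}
    (h0 : 0 ≤ q) (h1 : q ≤ 1) :
    outcomeAmp (cgtQuery x) (cosAmp F q) (sinAmp F q) ∅ false = (1 - q) ^ missing x F := by
  have hterm : ∀ T : Finset (Fin n), (if cgtQuery x T = false then
      reflectionProd (cosAmp F q) (sinAmp F q) ∅ T *
        reflectionProd (cosAmp F q) (sinAmp F q) ∅ T else 0) =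
      ∏ i, (if decide (i ∈ T) = true then (if x i = true then 0 else sinAmp F q i ^ 2)
        else cosAmp F q i ^ 2) := by
    intro T
    split_ifs with h
    · simp only [reflectionProd, ← Finset.prod_mul_distrib]
      refine Finset.prod_congr rfl fun i _ => ?_
      by_cases hT : i ∈ T
      · have hx : x i ≠ true := fun hx => of_decide_eq_false h ⟨i, hT, hx⟩
        simp [hT, hx, reflectionEntry, sq]
      · simp [hT, reflectionEntry, sq]
    · have : ∃ i ∈ T, x i = true := by
        by_contra hc
        exact h (decide_eq_false hc)
      obtain ⟨i, hT, hx⟩ := this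
      rw [Finset.prod_eq_zero (Finset.mem_univ i)]
      simp [hT, hx]
  rw [outcomeAmp, Finset.sum_congr rfl fun T _ => hterm T,
    sum_finset_prod fun i u => if u = true then (if x i = true then 0 else sinAmp F q i ^ 2)
        else cosAmp F q i ^ 2, missing, ← Finset.prod_const, Finset.prod_filter]
  refine Finset.prod_congr rfl fun i _ => ?_
  have hcs := cosAmp_sq_add_sinAmp_sq F h0 h1 i
  by_cases hx : x i = true
  · by_cases hF : i ∈ F
    · simp [hx, hF, cosAmp]
    · simp [hx, hF, cosAmp, Real.sq_sqrt (sub_nonneg.2 h1)]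
  · simp [hx]; linarith

theorem outcomeAmp_empty_add {n : ℕ} (f : Finset (Fin n) → Bool) {c s : Fin n → ℝ}
    (h : ∀ i, c i ^ 2 + s i ^ 2 = 1) :
    outcomeAmp f c s ∅ false + outcomeAmp f c s ∅ true = 1 := by
  have hsym : ∀ T, reflectionProd c s ∅ T = reflectionProd c s T ∅ := fun T =>
    Finset.prod_congr rfl fun i _ => by
      by_cases hT : i ∈ T <;> simp [hT, reflectionEntry]
  have h1 := sum_reflectionProd_mul h ∅ ∅
  rw [if_pos rfl] at h1
  rw [← h1, outcomeAmp, outcomeAmp, ← Finset.sum_add_distrib]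
  refine Finset.sum_congr rfl fun T _ => ?_
  rw [hsym]
  cases f T <;> simp

/-! ### The search algorithm -/

/-- What the control of the search algorithm knows: the set `F` of special items found so far, and
whether to test if there are others, to search for others, or to halt. -/
inductive SearchStage (n : ℕ) where
  | test (F : Finset (Fin n))
  | search (F : Finset (Fin n))
  | done (F : Finset (Fin n))

namespace SearchStage

variable {n : ℕ}

/-- The set of special items known at a stage. -/
def found : SearchStage n → Finset (Fin n)
  | test F => F
  | search F => F
  | done F => F

/-- The probability with which an item not yet found is in the queried set. -/
noncomputable def rate (k : ℕ) : SearchStage n → ℝ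
  | search _ => (2 * k)⁻¹
  | _ => 1

theorem rate_nonneg (k : ℕ) (σ : SearchStage n) : 0 ≤ σ.rate k := by
  cases σ <;> simp only [rate] <;> positivity

theorem rate_le_one (k : ℕ) (σ : SearchStage n) : σ.rate k ≤ 1 := by
  cases σ with
  | search F =>
    simp only [rate]
    rcases Nat.eq_zero_or_pos k with rfl | hk
    · simp
    · have : (1 : ℝ) ≤ k := by exact_mod_cast hk
      exact inv_le_one_of_one_le₀ (by linarith)
  | test F => exact le_rfl
  | done F => exact le_rfl

/-- The stage that follows the measurement of the set `U` and the answer `z`. -/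
def next : SearchStage n → QReg (Finset (Fin n)) 1 → SearchStage n
  | test F, i => if i.2.1 = true then search F else done F
  | search F, i => test (F ∪ i.1)
  | done F, _ => done F

/-- The step of the query algorithm at a stage: both a test and a search are queries. -/
def control : SearchStage n → ControlStep (Fin n → Bool)
  | done F => ControlStep.output fun i => decide (i ∈ F)
  | _ => ControlStep.query

/-- The measurement made at a stage: its rows are the orthonormal measurement basis. The row of
`(∅, false, 0)` is also the state that is prepared for the stage. -/
noncomputable def basis (k : ℕ) (σ : SearchStage n) :
    Matrix (QReg (Finset (Fin n)) 1) (QReg (Finset (Fin n)) 1) ℝ := fun o i =>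
  if o.2.1 = i.2.1 then
    reflectionProd (cosAmp σ.found (σ.rate k)) (sinAmp σ.found (σ.rate k)) o.1 i.1 else 0

theorem transpose_basis_mul_basis (k : ℕ) (σ : SearchStage n) :
    (σ.basis k).transpose * σ.basis k = 1 := by
  ext ⟨T, z, w⟩ ⟨T', z', w'⟩
  have h := sum_reflectionProd_mul (fun i =>
    cosAmp_sq_add_sinAmp_sq σ.found (σ.rate_nonneg k) (σ.rate_le_one k) i) T T'
  have hw : w = w' := Subsingleton.elim _ _
  simp only [Matrix.mul_apply, Matrix.transpose_apply, basis, Fintype.sum_prod_type,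
    Matrix.one_apply, Prod.mk.injEq, hw, and_true]
  cases z <;> cases z' <;> simp [h]

theorem basis_mul_transpose_basis (k : ℕ) (σ : SearchStage n) :
    σ.basis k * (σ.basis k).transpose = 1 :=
  mul_eq_one_comm.1 (σ.transpose_basis_mul_basis k)

/-- The state prepared for a stage: the items are in superposition and the answer qubit is `0`. -/
noncomputable def prep (k : ℕ) (σ : SearchStage n) : QReg (Finset (Fin n)) 1 → ℝ :=
  σ.basis k (∅, false, 0)

theorem prep_dotProduct_prep (k : ℕ) (σ : SearchStage n) : σ.prep k ⬝ᵥ σ.prep k = 1 := by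
  have := congrFun (congrFun (σ.basis_mul_transpose_basis k) (∅, false, 0)) (∅, false, 0)
  rwa [Matrix.one_apply_eq, Matrix.mul_apply] at this

/-- The probability of the measurement outcome `o` at a querying stage. -/
noncomputable def outcomeProb (k : ℕ) (σ : SearchStage n) (f : Finset (Fin n) → Bool)
    (o : QReg (Finset (Fin n)) 1) : ℝ :=
  outcomeAmp f (cosAmp σ.found (σ.rate k)) (sinAmp σ.found (σ.rate k)) o.1 o.2.1 ^ 2

theorem sum_basis_mul_prep (k : ℕ) (σ : SearchStage n) (f : Finset (Fin n) → Bool)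
    (o : QReg (Finset (Fin n)) 1) :
    ∑ i : QReg (Finset (Fin n)) 1, σ.basis k o i * σ.prep k (i.1, xor i.2.1 (f i.1), i.2.2) =
      outcomeAmp f (cosAmp σ.found (σ.rate k)) (sinAmp σ.found (σ.rate k)) o.1 o.2.1 := by
  obtain ⟨U, z, w⟩ := o
  simp only [prep, basis, Fintype.sum_prod_type, outcomeAmp]
  refine Finset.sum_congr rfl fun T _ => ?_
  cases f T <;> cases z <;> simp

end SearchStage

section Enumeration

variable {α : Type*} [Fintype α]

/-- An enumeration of a finite type by the natural numbers below its cardinality, with the value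
`a` elsewhere. -/
noncomputable def enumFrom (a : α) (o : ℕ) : α :=
  if h : o < Fintype.card α then (Fintype.equivFin α).symm ⟨o, h⟩ else a

theorem sum_range_enumFrom {M : Type*} [AddCommMonoid M] (a : α) (g : α → M) :
    ∑ o ∈ Finset.range (Fintype.card α), g (enumFrom a o) = ∑ i, g i := by
  rw [Finset.sum_range, ← Equiv.sum_comp (Fintype.equivFin α).symm]
  exact Finset.sum_congr rfl fun o _ => by simp [enumFrom]

end Enumeration

/-- The measurement outcome, a basis state of the register, with a given number. -/
noncomputable def decodeOutcome {n : ℕ} : ℕ → QReg (Finset (Fin n)) 1 :=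
  enumFrom (∅, false, 0)

/-- The stage of the search algorithm at a transcript. If there are no special items, it halts at
once. -/
noncomputable def searchStage (n k : ℕ) : List ℕ → SearchStage n
  | [] => if k = 0 then SearchStage.done ∅ else SearchStage.test ∅
  | o :: h => (searchStage n k h).next (decodeOutcome o)

/-- The search algorithm. All its instruments measure in an orthonormal basis and prepare the
state for the next stage. -/
noncomputable def searchAlgorithm (n k : ℕ) : CGTAlgorithm n where
  dim _ := 1
  control h := (searchStage n k h).control
  init i := ((searchStage n k []).prep k i : ℂ)
  init_unit := by
    have := (searchStage n k []).prep_dotProduct_prep k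
    rw [← this]
    exact Finset.sum_congr rfl fun i _ => by rw [Complex.norm_real, Real.norm_eq_abs, sq_abs, sq]
  outcomes _ := Fintype.card (QReg (Finset (Fin n)) 1)
  kraus h o := (Matrix.vecMulVec ((searchStage n k (o :: h)).prep k)
    ((searchStage n k h).basis k (decodeOutcome o))).map Complex.ofReal
  kraus_complete h := by
    have hterm : ∀ o : ℕ, ((Matrix.vecMulVec ((searchStage n k (o :: h)).prep k)
        ((searchStage n k h).basis k (decodeOutcome o))).map Complex.ofReal).conjTranspose *
        (Matrix.vecMulVec ((searchStage n k (o :: h)).prep k)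
        ((searchStage n k h).basis k (decodeOutcome o))).map Complex.ofReal =
        (Matrix.vecMulVec ((searchStage n k h).basis k (decodeOutcome o))
          ((searchStage n k h).basis k (decodeOutcome o))).map Complex.ofReal := by
      intro o
      have := (searchStage n k (o :: h)).prep_dotProduct_prep k
      ext i j
      simp only [dotProduct] at this
      simp only [Matrix.mul_apply, Matrix.conjTranspose_apply, Matrix.map_apply,
        Matrix.vecMulVec_apply, RCLike.star_def, Complex.conj_ofReal]
      rw [← one_mul ((searchStage n k h).basis k (decodeOutcome o) i * _), ← this, Finset.sum_mul]
      push_cast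
      exact Finset.sum_congr rfl fun l _ => by ring
    simp only [hterm]
    rw [decodeOutcome, sum_range_enumFrom _ fun o =>
      (Matrix.vecMulVec ((searchStage n k h).basis k o)
          ((searchStage n k h).basis k o)).map Complex.ofReal]
    have h1 := (searchStage n k h).transpose_basis_mul_basis k
    ext i j
    have h2 := congrFun (congrFun h1 i) j
    simp only [Matrix.mul_apply, Matrix.transpose_apply] at h2
    simp only [Matrix.sum_apply, Matrix.map_apply, Matrix.vecMulVec_apply]
    rw [← Complex.ofReal_sum, h2]
    simp only [Matrix.one_apply]
    split_ifs <;> simp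

/-! ### Course of the search algorithm -/

theorem searchAlgorithm_kraus_mulVec (n k : ℕ) (h : List ℕ) (o : ℕ)
    (v : QReg (Finset (Fin n)) 1 → ℝ) :
    ((searchAlgorithm n k).kraus h o).mulVec (fun i => ((v i : ℝ) : ℂ)) = fun i =>
      (((∑ j, (searchStage n k h).basis k (decodeOutcome o) j * v j) *
        (searchStage n k (o :: h)).prep k i : ℝ) : ℂ) := by
  ext i
  rw [Matrix.mulVec, dotProduct, Finset.sum_mul, Complex.ofReal_sum]
  refine Finset.sum_congr rfl fun j _ => ?_
  have : (searchAlgorithm n k).kraus h o i j =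
      (((searchStage n k (o :: h)).prep k i *
        (searchStage n k h).basis k (decodeOutcome o) j : ℝ) : ℂ) := rfl
  rw [this, ← Complex.ofReal_mul]
  congr 1
  ring

/-- At every transcript the state is a multiple of the prepared state, so that the run is a
classical random walk on the stages. -/
theorem exists_searchAlgorithm_state (n k : ℕ) (f : Finset (Fin n) → Bool) (h : List ℕ) :
    ∃ a : ℝ, (searchAlgorithm n k).state f h =
        (fun i => ((a * (searchStage n k h).prep k i : ℝ) : ℂ)) ∧
      ∀ o ∈ Finset.range (Fintype.card (QReg (Finset (Fin n)) 1)),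
        (searchAlgorithm n k).control h = ControlStep.query →
        (searchAlgorithm n k).state f (o :: h) = fun i =>
          ((a * outcomeAmp f (cosAmp (searchStage n k h).found ((searchStage n k h).rate k))
            (sinAmp (searchStage n k h).found ((searchStage n k h).rate k))
            (decodeOutcome (n := n) o).1 (decodeOutcome (n := n) o).2.1 *
              (searchStage n k (o :: h)).prep k i : ℝ) : ℂ) := by
  have hstep : ∀ (h : List ℕ) (a : ℝ), (searchAlgorithm n k).state f h =
        (fun i => ((a * (searchStage n k h).prep k i : ℝ) : ℂ)) →
      ∀ o ∈ Finset.range (Fintype.card (QReg (Finset (Fin n)) 1)),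
        (searchAlgorithm n k).control h = ControlStep.query →
        (searchAlgorithm n k).state f (o :: h) = fun i =>
          ((a * outcomeAmp f (cosAmp (searchStage n k h).found ((searchStage n k h).rate k))
            (sinAmp (searchStage n k h).found ((searchStage n k h).rate k))
            (decodeOutcome (n := n) o).1 (decodeOutcome (n := n) o).2.1 *
              (searchStage n k (o :: h)).prep k i : ℝ) : ℂ) := by
    intro h a ha o ho hc
    have ho' : o < (searchAlgorithm n k).outcomes h := Finset.mem_range.1 ho
    rw [QueryAlgorithm.state, if_pos ho', hc, ha]
    refine (searchAlgorithm_kraus_mulVec n k h o fun i =>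
      a * (searchStage n k h).prep k (i.1, xor i.2.1 (f i.1), i.2.2)).trans ?_
    have e : ∑ j : QReg (Finset (Fin n)) 1, (searchStage n k h).basis k (decodeOutcome o) j *
        (a * (searchStage n k h).prep k (j.1, xor j.2.1 (f j.1), j.2.2)) =
        a * outcomeAmp f (cosAmp (searchStage n k h).found ((searchStage n k h).rate k))
            (sinAmp (searchStage n k h).found ((searchStage n k h).rate k))
            (decodeOutcome (n := n) o).1 (decodeOutcome (n := n) o).2.1 := by
      rw [← SearchStage.sum_basis_mul_prep, Finset.mul_sum]
      exact Finset.sum_congr rfl fun j _ => by ring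
    rw [e]
  suffices hs : ∃ a : ℝ, (searchAlgorithm n k).state f h =
      (fun i => ((a * (searchStage n k h).prep k i : ℝ) : ℂ)) by
    obtain ⟨a, ha⟩ := hs
    exact ⟨a, ha, hstep h a ha⟩
  induction h with
  | nil => exact ⟨1, funext fun i => by rw [one_mul]; rfl⟩
  | cons o h ih =>
    obtain ⟨a, ha⟩ := ih
    by_cases ho : o < (searchAlgorithm n k).outcomes h
    · cases hc : (searchAlgorithm n k).control h with
      | query => exact ⟨_, hstep h a ha o (Finset.mem_range.2 ho) hc⟩
      | output y =>
        refine ⟨0, funext fun i => ?_⟩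
        rw [QueryAlgorithm.state, if_pos ho, hc]
        simp
      | measure =>
        have : (searchStage n k h).control = ControlStep.measure := hc
        cases hs : searchStage n k h <;> rw [hs] at this <;> simp [SearchStage.control] at this
    · refine ⟨0, funext fun i => ?_⟩
      rw [QueryAlgorithm.state, if_neg ho]
      simp

theorem weight_searchAlgorithm_cons (n k : ℕ) (f : Finset (Fin n) → Bool) (h : List ℕ)
    (hc : (searchStage n k h).control = ControlStep.query) {o : ℕ}
    (ho : o ∈ Finset.range (Fintype.card (QReg (Finset (Fin n)) 1))) :
    (searchAlgorithm n k).weight f (o :: h) = (searchAlgorithm n k).weight f h *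
      (searchStage n k h).outcomeProb k f (decodeOutcome o) := by
  obtain ⟨a, ha, hstep⟩ := exists_searchAlgorithm_state n k f h
  have hw : ∀ (h' : List ℕ) (b : ℝ), (searchAlgorithm n k).state f h' =
      (fun i => ((b * (searchStage n k h').prep k i : ℝ) : ℂ)) →
      (searchAlgorithm n k).weight f h' = b ^ 2 := by
    intro h' b hb
    have h1 := (searchStage n k h').prep_dotProduct_prep k
    rw [QueryAlgorithm.weight, hb, ← mul_one (b ^ 2), ← h1, dotProduct, Finset.mul_sum]
    refine Finset.sum_congr rfl fun i _ => ?_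
    rw [Complex.norm_real, Real.norm_eq_abs, sq_abs]
    ring
  rw [hw h a ha, hw (o :: h) _ (hstep o ho hc), SearchStage.outcomeProb, mul_pow]

theorem weight_searchAlgorithm_cons_done (n k : ℕ) (f : Finset (Fin n) → Bool) (h : List ℕ)
    {y : Fin n → Bool} (hc : (searchStage n k h).control = ControlStep.output y) (o : ℕ) :
    (searchAlgorithm n k).weight f (o :: h) = 0 := by
  have hc' : (searchAlgorithm n k).control h = ControlStep.output y := hc
  simp [QueryAlgorithm.weight, QueryAlgorithm.state, hc']

theorem sum_weight_searchAlgorithm (n k : ℕ) (f : Finset (Fin n) → Bool) (h : List ℕ)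
    (hc : (searchStage n k h).control = ControlStep.query)
    (g : QReg (Finset (Fin n)) 1 → ℝ) :
    ∑ o ∈ Finset.range (Fintype.card (QReg (Finset (Fin n)) 1)),
      (searchAlgorithm n k).weight f (o :: h) * g (decodeOutcome o) =
    (searchAlgorithm n k).weight f h * ∑ i, (searchStage n k h).outcomeProb k f i * g i := by
  rw [Finset.mul_sum, ← sum_range_enumFrom (∅, false, 0)]
  refine Finset.sum_congr rfl fun o ho => ?_
  rw [weight_searchAlgorithm_cons n k f h hc ho, mul_assoc]
  rfl

/-- What is certain at a stage, for the input `x`: all items found are special; a search happens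
only if there are others; and the algorithm halts only if there are none. -/
def SearchStage.Valid {n : ℕ} (x : Fin n → Bool) : SearchStage n → Prop
  | test F => ∀ i ∈ F, x i = true
  | search F => (∀ i ∈ F, x i = true) ∧ 0 < missing x F
  | done F => (fun i => decide (i ∈ F)) = x

theorem SearchStage.Valid.next {n k : ℕ} {x : Fin n → Bool} {σ : SearchStage n}
    (hσ : σ.Valid x) {o : QReg (Finset (Fin n)) 1} (ho : σ.outcomeProb k (cgtQuery x) o ≠ 0) :
    (σ.next o).Valid x := by
  have ho' := pow_ne_zero_iff (two_ne_zero) |>.1 ho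
  cases σ with
  | test F =>
    have hz : cgtQuery x Fᶜ = o.2.1 := by
      by_contra hc
      exact ho' (outcomeAmp_one _ hc)
    by_cases h : o.2.1 = true
    · rw [h] at hz
      obtain ⟨i, hi, hx⟩ := of_decide_eq_true hz
      simp only [SearchStage.next, if_pos h]
      exact ⟨hσ, Finset.card_pos.2 ⟨i, by simpa [hx] using hi⟩⟩
    · rw [Bool.not_eq_true] at h
      rw [h] at hz
      have hz' := of_decide_eq_false hz
      simp only [SearchStage.next, h, Bool.false_eq_true, if_false]
      funext i
      by_cases hi : i ∈ F
      · simp [hi, hσ i hi]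
      · have : x i ≠ true := fun hx => hz' ⟨i, Finset.mem_compl.2 hi, hx⟩
        simp [hi, this]
  | search F =>
    intro i hi
    rcases Finset.mem_union.1 hi with h | h
    · exact hσ.1 i h
    · by_contra hx
      exact ho' (outcomeAmp_eq_zero_of_indep h
        (cgtQuery_symmDiff (Bool.not_eq_true _ ▸ hx)) _)
  | done F => exact hσ

theorem valid_searchStage {n k : ℕ} {x : Fin n → Bool} (hx : hammingWt x ≤ k) (h : List ℕ)
    (hw : (searchAlgorithm n k).weight (cgtQuery x) h ≠ 0) : (searchStage n k h).Valid x := by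
  induction h with
  | nil =>
    rw [searchStage]
    split_ifs with hk
    · subst hk
      have hx0 := Finset.card_eq_zero.1 (Nat.le_zero.1 hx)
      funext i
      have : x i ≠ true := fun hi => by
        have : i ∈ (∅ : Finset (Fin n)) := hx0 ▸ Finset.mem_filter.2 ⟨Finset.mem_univ i, hi⟩
        simp at this
      simp [this]
    · intro i hi
      simp at hi
  | cons o h ih =>
    have ho : o ∈ Finset.range (Fintype.card (QReg (Finset (Fin n)) 1)) := by
      by_contra hc
      apply hw
      have hc' : ¬ o < (searchAlgorithm n k).outcomes h := fun h => hc (Finset.mem_range.2 h)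
      simp [QueryAlgorithm.weight, QueryAlgorithm.state, hc']
    have hc : (searchStage n k h).control = ControlStep.query := by
      cases hs : searchStage n k h with
      | done F =>
        exact absurd (weight_searchAlgorithm_cons_done n k _ h (congrArg _ hs) o) hw
      | _ => rfl
    rw [weight_searchAlgorithm_cons n k _ h hc ho] at hw
    exact (ih (left_ne_zero_of_mul hw)).next (right_ne_zero_of_mul hw)

/-! ### Expected number of queries of the search algorithm -/

/-- A bound for the expected number of queries from a test on, when `j` special items are
missing. -/
noncomputable def testCost (k j : ℕ) : ℝ := 1 + 6 * k * (harmonic j : ℝ)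

theorem testCost_succ (k j : ℕ) :
    testCost k (j + 1) = testCost k j + 6 * k / (j + 1 : ℝ) := by
  rw [testCost, testCost, harmonic_succ]
  push_cast
  ring

theorem testCost_mono (k : ℕ) : Monotone (testCost k) :=
  monotone_nat_of_le_succ fun j => by
    rw [testCost_succ]
    exact le_add_of_nonneg_right (by positivity)

theorem one_le_testCost (k j : ℕ) : 1 ≤ testCost k j := by
  have h : testCost k 0 = 1 := by simp [testCost]
  exact h ▸ testCost_mono k (Nat.zero_le j)

/-- A bound for the expected number of queries from a stage on. -/
noncomputable def SearchStage.cost {n : ℕ} (k : ℕ) (x : Fin n → Bool) : SearchStage n → ℝ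
  | test F => testCost k (missing x F)
  | search F => testCost k (missing x F) - 1
  | done _ => 0

theorem SearchStage.cost_nonneg {n : ℕ} (k : ℕ) (x : Fin n → Bool) (σ : SearchStage n) :
    0 ≤ σ.cost k x := by
  cases σ with
  | test F => exact zero_le_one.trans (one_le_testCost _ _)
  | search F => exact sub_nonneg.2 (one_le_testCost _ _)
  | done F => exact le_rfl

/-- A search with `j ≤ k` missing items finds some of them with probability at least
`j / (3 * k)`. -/
theorem progress_bound {k j : ℕ} (hj : 0 < j) (hjk : j ≤ k) :
    (j : ℝ) / (3 * k) ≤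
      1 - (((1 - (2 * k : ℝ)⁻¹) ^ j) ^ 2 + (1 - (1 - (2 * k : ℝ)⁻¹) ^ j) ^ 2) := by
  have hk : (0 : ℝ) < k := by exact_mod_cast hj.trans_le hjk
  have hk1 : (1 : ℝ) ≤ k := by exact_mod_cast hj.trans_le hjk
  have hjk' : (j : ℝ) ≤ k := by exact_mod_cast hjk
  have hj' : (0 : ℝ) < j := by exact_mod_cast hj
  set q : ℝ := (2 * k : ℝ)⁻¹ with hq
  have hq0 : 0 < q := by positivity
  have hq1 : q ≤ 1 / 2 := by
    rw [hq, inv_le_comm₀ (by positivity) (by norm_num)]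
    linarith
  have hjq : j * q ≤ 1 / 2 := by
    rw [hq, ← div_eq_mul_inv, div_le_div_iff₀ (by positivity) (by norm_num)]
    linarith
  set y := (1 - q) ^ j with hy
  have hy1 : 1 / 2 ≤ y := by
    have := one_add_mul_le_pow (a := -q) (by linarith) j
    rw [← sub_eq_add_neg] at this
    linarith
  -- `(1 - q) ^ j * (1 + q) ^ j ≤ 1`
  have hy2 : y * (1 + j * q) ≤ 1 := by
    have h1 := one_add_mul_le_pow (a := q) (by linarith) j
    have h2 : y * (1 + q) ^ j ≤ 1 := by
      rw [hy, ← mul_pow]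
      exact pow_le_one₀ (by nlinarith) (by nlinarith)
    exact (mul_le_mul_of_nonneg_left h1 (by linarith)).trans h2
  have hgoal : (j : ℝ) / (3 * k) = 2 / 3 * (j * q) := by
    rw [hq]; field_simp
  rw [hgoal]
  nlinarith [mul_nonneg (sub_nonneg.2 hy1) hj'.le, mul_pos hj' hq0]

theorem SearchStage.sum_outcomeProb_empty {n k : ℕ} {x : Fin n → Bool} (F : Finset (Fin n)) :
    ∑ i, (search F).outcomeProb k (cgtQuery x) i * (if i.1 = ∅ then 1 else 0) =
      ((1 - (2 * k : ℝ)⁻¹) ^ missing x F) ^ 2 +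
        (1 - (1 - (2 * k : ℝ)⁻¹) ^ missing x F) ^ 2 := by
  have h0 := (search F).rate_nonneg k
  have h1 := (search F).rate_le_one k
  have hf := outcomeAmp_empty_false x F h0 h1
  have ha := outcomeAmp_empty_add (cgtQuery x) (cosAmp_sq_add_sinAmp_sq F h0 h1)
  rw [hf] at ha
  rw [Fintype.sum_prod_type, Finset.sum_eq_single ∅]
  · simp only [Fintype.sum_prod_type, Fintype.sum_bool, Finset.univ_unique, Finset.sum_singleton,
      outcomeProb, found, hf, eq_sub_of_add_eq' ha, if_true, mul_one]
    simp only [rate]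
    ring
  · intro U _ hU
    simp [hU]
  · simp

/-- The potential `SearchStage.cost` drops by at least one query on average. -/
theorem sum_weight_mul_cost_le {n k : ℕ} {x : Fin n → Bool} (hx : hammingWt x ≤ k) (h : List ℕ)
    (hc : (searchStage n k h).control = ControlStep.query) :
    ∑ o ∈ Finset.range (Fintype.card (QReg (Finset (Fin n)) 1)),
      (searchAlgorithm n k).weight (cgtQuery x) (o :: h) * (searchStage n k (o :: h)).cost k x ≤
    (searchAlgorithm n k).weight (cgtQuery x) h * ((searchStage n k h).cost k x - 1) := by
  by_cases hw : (searchAlgorithm n k).weight (cgtQuery x) h = 0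
  · rw [Finset.sum_eq_zero fun o ho => ?_, hw, zero_mul]
    rw [weight_searchAlgorithm_cons n k _ h hc ho, hw, zero_mul, zero_mul]
  have hw0 := (searchAlgorithm n k).weight_nonneg (cgtQuery x) h
  have hvalid := valid_searchStage hx h hw
  have hone : ∑ i, (searchStage n k h).outcomeProb k (cgtQuery x) i = 1 := by
    have h1 := (searchAlgorithm n k).sum_weight_of_not_output (cgtQuery x) (h := h) fun y hy => by
      have : (searchStage n k h).control = ControlStep.output y := hy
      rw [hc] at this
      cases this
    have h2 := sum_weight_searchAlgorithm n k (cgtQuery x) h hc fun _ => 1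
    simp only [mul_one] at h2
    exact mul_left_cancel₀ hw (by rw [← h2, mul_one]; exact h1)
  have hsum := sum_weight_searchAlgorithm n k (cgtQuery x) h hc fun i =>
    ((searchStage n k h).next i).cost k x
  refine hsum.le.trans (mul_le_mul_of_nonneg_left ?_ hw0)
  generalize searchStage n k h = σ at *
  have hp : ∀ i, 0 ≤ σ.outcomeProb k (cgtQuery x) i := fun i => sq_nonneg _
  cases σ with
  | done F => cases hc
  | test F =>
    calc _ ≤ ∑ i, (SearchStage.test F).outcomeProb k (cgtQuery x) i *
          ((SearchStage.test F).cost k x - 1) := by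
          refine Finset.sum_le_sum fun i _ => mul_le_mul_of_nonneg_left ?_ (hp i)
          simp only [SearchStage.next]
          split_ifs
          · exact le_rfl
          · exact sub_nonneg.2 (one_le_testCost _ _)
      _ = _ := by rw [← Finset.sum_mul, hone, one_mul]
  | search F =>
    obtain ⟨hF, hm⟩ := hvalid
    obtain ⟨j, hj⟩ := Nat.exists_eq_succ_of_ne_zero hm.ne'
    have hjk : j + 1 ≤ k := by
      rw [← Nat.succ_eq_add_one, ← hj]
      refine le_trans (Finset.card_le_card fun i hi => ?_) hx
      simp only [Finset.mem_filter, Finset.mem_univ, true_and] at hi ⊢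
      exact hi.1
    calc _ ≤ ∑ i, (SearchStage.search F).outcomeProb k (cgtQuery x) i *
          (testCost k j + (if i.1 = ∅ then 1 else 0) * (testCost k (j + 1) - testCost k j)) := by
          refine Finset.sum_le_sum fun i _ => ?_
          by_cases hi0 : (SearchStage.search F).outcomeProb k (cgtQuery x) i = 0
          · rw [hi0, zero_mul, zero_mul]
          refine mul_le_mul_of_nonneg_left ?_ (hp i)
          have hi0' := pow_ne_zero_iff (two_ne_zero) |>.1 hi0
          simp only [SearchStage.next, SearchStage.cost]
          by_cases hU : i.1 = ∅
          · rw [if_pos hU, hU, Finset.union_empty, hj]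
            simp
          · rw [if_neg hU, zero_mul, add_zero]
            refine testCost_mono k (Nat.lt_succ_iff.1 (hj ▸ Finset.card_lt_card ?_))
            obtain ⟨l, hl⟩ := Finset.nonempty_iff_ne_empty.2 hU
            have hlF : l ∉ F := fun hlF => hi0' (outcomeAmp_of_mem _ hlF hl _)
            have hlx : x l = true := by
              by_contra hlx
              exact hi0' (outcomeAmp_eq_zero_of_indep hl
                (cgtQuery_symmDiff (Bool.not_eq_true _ ▸ hlx)) _)
            rw [Finset.ssubset_iff_of_subset]
            · exact ⟨l, by simp [hlx, hlF], by simp [hl]⟩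
            · intro a ha
              simp only [Finset.mem_filter, Finset.mem_univ, true_and, Finset.mem_union,
                not_or] at ha ⊢
              exact ⟨ha.1, ha.2.1⟩
      _ = testCost k j + (((1 - (2 * k : ℝ)⁻¹) ^ (j + 1)) ^ 2 +
            (1 - (1 - (2 * k : ℝ)⁻¹) ^ (j + 1)) ^ 2) * (testCost k (j + 1) - testCost k j) := by
          simp only [mul_add, Finset.sum_add_distrib, ← mul_assoc, ← Finset.sum_mul]
          rw [hone, SearchStage.sum_outcomeProb_empty, hj, one_mul]
      _ ≤ testCost k (j + 1) - 1 - 1 := by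
          have hb := progress_bound (j := j + 1) (Nat.succ_pos j) hjk
          have hk : (0 : ℝ) < k := by exact_mod_cast (Nat.succ_pos j).trans_le hjk
          have hd : testCost k (j + 1) - testCost k j = 6 * k / (j + 1 : ℝ) := by
            rw [testCost_succ]; ring
          have hd0 : 0 ≤ 6 * k / (j + 1 : ℝ) := by positivity
          have h2 : ((j + 1 : ℕ) : ℝ) / (3 * k) * (6 * k / (j + 1 : ℝ)) = 2 := by
            push_cast
            field_simp
            norm_num
          have := mul_le_mul_of_nonneg_right hb hd0
          rw [h2] at this
          rw [sub_mul, one_mul] at this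
          rw [hd]
          linarith
      _ = _ := by simp only [SearchStage.cost, hj]

theorem queriesUpTo_searchAlgorithm_le {n k : ℕ} {x : Fin n → Bool} (hx : hammingWt x ≤ k)
    (m : ℕ) :
    (searchAlgorithm n k).queriesUpTo (cgtQuery x) m ≤ (searchStage n k []).cost k x := by
  have ht := (searchAlgorithm n k).sum_level_add_sum_drop
    (fun h => (searchAlgorithm n k).weight (cgtQuery x) h * (searchStage n k h).cost k x) m
  rw [QueryAlgorithm.weight_nil, one_mul] at ht
  rw [← ht]
  refine le_add_of_nonneg_of_le (Finset.sum_nonneg fun h _ =>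
    mul_nonneg (QueryAlgorithm.weight_nonneg _ _ _) (SearchStage.cost_nonneg k x _)) ?_
  refine Finset.sum_le_sum fun j _ => ?_
  rw [Finset.sum_filter]
  refine Finset.sum_le_sum fun h _ => ?_
  have hw := (searchAlgorithm n k).weight_nonneg (cgtQuery x) h
  by_cases hc : (searchStage n k h).control = ControlStep.query
  · have hc' : (searchAlgorithm n k).control h = ControlStep.query := hc
    have := sum_weight_mul_cost_le hx h hc
    rw [if_pos hc']
    change _ ≤ _ - ∑ o ∈ Finset.range (Fintype.card (QReg (Finset (Fin n)) 1)), _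
    linarith
  · have hc' : ¬(searchAlgorithm n k).control h = ControlStep.query := hc
    obtain ⟨y, hy⟩ : ∃ y, (searchStage n k h).control = ControlStep.output y := by
      cases hs : searchStage n k h with
      | done F => exact ⟨_, rfl⟩
      | test F => rw [hs] at hc; exact absurd rfl hc
      | search F => rw [hs] at hc; exact absurd rfl hc
    rw [if_neg hc', Finset.sum_eq_zero fun o _ => by
      rw [weight_searchAlgorithm_cons_done n k _ h hy, zero_mul], sub_zero]
    exact mul_nonneg hw (SearchStage.cost_nonneg k x _)

theorem expectedQueries_searchAlgorithm_le {n k : ℕ} {x : Fin n → Bool} (hx : hammingWt x ≤ k) :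
    (searchAlgorithm n k).expectedQueries (cgtQuery x) ≤
      ENNReal.ofReal ((searchStage n k []).cost k x) := by
  classical
  rw [QueryAlgorithm.expectedQueries, QueryAlgorithm.tsum_reachProb _ _
    fun h => (searchAlgorithm n k).control h = ControlStep.query]
  refine ENNReal.tsum_le_of_sum_range_le fun m => ?_
  rw [← ENNReal.ofReal_sum_of_nonneg fun j _ => Finset.sum_nonneg fun h _ =>
    QueryAlgorithm.weight_nonneg _ _ h]
  exact ENNReal.ofReal_le_ofReal (queriesUpTo_searchAlgorithm_le hx m)

/-- The run halts almost surely, because the expected number of queries is finite, and every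
output is correct. -/
theorem solvesCGT_searchAlgorithm (n k : ℕ) : SolvesCGT k (searchAlgorithm n k) 1 := by
  classical
  intro x hx
  set A := searchAlgorithm n k
  set q : ℕ → ℝ := fun m => ∑ h ∈ (A.level m).filter
    (fun h => A.control h = ControlStep.query), A.weight (cgtQuery x) h with hq
  have hq0 : Filter.Tendsto q Filter.atTop (nhds 0) :=
    (summable_of_sum_range_le (c := (searchStage n k []).cost k x)
      (fun m => Finset.sum_nonneg fun h _ => A.weight_nonneg _ h)
      fun m => queriesUpTo_searchAlgorithm_le hx m).tendsto_atTop_zero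
  have hout : ∀ h, A.weight (cgtQuery x) h ≠ 0 → A.control h ≠ ControlStep.query →
      A.control h = ControlStep.output x := by
    intro h hw hc
    have hv := valid_searchStage hx h hw
    change (searchStage n k h).control = _
    change (searchStage n k h).control ≠ _ at hc
    cases hs : searchStage n k h with
    | done F =>
      rw [hs] at hv
      exact congrArg ControlStep.output hv
    | test F => rw [hs] at hc; exact absurd rfl hc
    | search F => rw [hs] at hc; exact absurd rfl hc
  have hcons : ∀ m, 1 - q m = A.outputUpTo (cgtQuery x) x (m + 1) := by
    intro m
    have h1 := A.sum_weight_level_add_outputUpTo (cgtQuery x) x (fun h y hw hc => by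
      have := hout h hw (by simp [hc])
      rw [hc] at this
      exact ControlStep.output.inj this) m
    have h3 : ∑ h ∈ A.level m, A.weight (cgtQuery x) h = q m + ∑ h ∈ (A.level m).filter
          (fun h => A.control h = ControlStep.output x), A.weight (cgtQuery x) h := by
      simp only [hq]
      rw [Finset.sum_filter, Finset.sum_filter, ← Finset.sum_add_distrib]
      refine Finset.sum_congr rfl fun h _ => ?_
      by_cases hw : A.weight (cgtQuery x) h = 0
      · simp [hw]
      · by_cases hc : A.control h = ControlStep.query
        · simp [hc]
        · simp [hout h hw hc]
    rw [h3, QueryAlgorithm.outputUpTo] at h1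
    rw [QueryAlgorithm.outputUpTo, Finset.sum_range_succ, ← h1]
    ring
  have hlim : Filter.Tendsto (fun m => ENNReal.ofReal (1 - q m)) Filter.atTop
      (nhds (ENNReal.ofReal 1)) := by
    have := ENNReal.tendsto_ofReal (hq0.const_sub 1)
    rwa [sub_zero] at this
  refine le_of_tendsto' hlim fun m => ?_
  rw [hcons]
  exact A.outputUpTo_le _ _ _

theorem cost_searchStage_nil_le {n k : ℕ} {x : Fin n → Bool} (hx : hammingWt x ≤ k) :
    (searchStage n k []).cost k x ≤ 20 * (k * Real.log (k + 1)) := by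
  rw [searchStage]
  split_ifs with hk
  · simp [hk, SearchStage.cost]
  · have hk1 : (1 : ℝ) ≤ k := by exact_mod_cast Nat.one_le_iff_ne_zero.2 hk
    have hm : missing x ∅ ≤ k := by
      refine le_trans (Finset.card_le_card fun i hi => ?_) hx
      simp only [Finset.mem_filter, Finset.mem_univ, true_and] at hi ⊢
      exact hi.1
    have h1 : testCost k (missing x ∅) ≤ testCost k k := testCost_mono k hm
    have h2 : (harmonic k : ℝ) ≤ 1 + Real.log k := harmonic_le_one_add_log k
    have h3 : Real.log k ≤ Real.log (k + 1) := Real.log_le_log (by linarith) (by linarith)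
    have h4 : 1 / 2 ≤ Real.log (k + 1) := by
      have := Real.log_le_log (x := 2) (y := k + 1) (by norm_num) (by linarith)
      have := Real.log_two_gt_d9
      linarith
    have h5 := mul_le_mul_of_nonneg_left (h2.trans (add_le_add_right h3 1))
      (by linarith : (0 : ℝ) ≤ 6 * k)
    have h6 := mul_le_mul_of_nonneg_left h4 (by linarith : (0 : ℝ) ≤ k)
    have h7 : testCost k k = 1 + 6 * k * (harmonic k : ℝ) := rfl
    change testCost k (missing x ∅) ≤ _
    linarith

theorem theorem2 :
    (∃ C : ℝ, 0 < C ∧ ∀ n k : ℕ, ∃ A : CGTAlgorithm n, SolvesCGT k A 1 ∧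
      ∀ x : Fin n → Bool, hammingWt x ≤ k →
        A.expectedQueries (cgtQuery x) ≤ ENNReal.ofReal (C * (k * Real.log (k + 1)))) ∧
    (∀ ε : ℝ, 0 ≤ ε → ε < 1 / 2 → ∃ c : ℝ, 0 < c ∧ ∀ n k : ℕ, k ≤ n →
      ∀ A : CGTAlgorithm n, SolvesCGT k A (1 - ε) →
        ∃ x : Fin n → Bool, hammingWt x ≤ k ∧
          ENNReal.ofReal (c * Real.sqrt k) ≤ A.expectedQueries (cgtQuery x)) := by
  refine ⟨⟨20, by norm_num, fun n k => ⟨searchAlgorithm n k, solvesCGT_searchAlgorithm n k,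
    fun x hx => ?_⟩⟩, fun ε _ h1 => cgt_lower_bound h1⟩
  exact (expectedQueries_searchAlgorithm_le hx).trans
    (ENNReal.ofReal_le_ofReal (cost_searchStage_nil_le hx))
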